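/- Let $A\subseteq\mathbb{R}^d$ be a closed convex set, $Y$ a real Banach space with topological dual $Y^*$, $K\subseteq Y$ a nonempty closed convex cone, $W=\{1,\dots,m\}$ with $m\ge 1$, $f_1,\dots,f_m\colon\mathbb{R}^d\to\mathbb{R}$, $G\colon\mathbb{R}^d\to Y$, and $F(x)=\max_{1\le i\le m} f_i(x)$. Consider the problem $$\min F(x)\quad\text{subject to}\quad G(x)\in K,\ x\in A. \qquad(\mathcal P)$$ Let $x_*\in\operatorname{int}A$ be a locally optimal solution of $(\mathcal P)$, suppose that all $f_i$ and $G$ are twice continuously (Fréchet) differentiable in a neighbourhood of $x_*$, and suppose that Robinson's constraint qualification holds at $x_*$: $$0\in\operatorname{int}\{G(x_*)+DG(x_*)(A-x_*)-K\}.$$ Notation. For a subset $C$ of a normed space and $x\in C$, the contingent cone $T_C(x)$ is the set of all $h$ for which there are $\alpha_n>0$, $\alpha_n\to0$, and $h_n\to h$ with $x+\alpha_nh_n\in C$ for all $n$. For $S\subseteq Y$, $y\in S$ and $v\in Y$, the outer second order tangent set $T^2_S(y,v)$ is the set of all $w\in Y$ for which there are $t_n>0$, $t_n\to0$, with $\operatorname{dist}(y+t_nv+\tfrac12t_n^2w,S)=o(t_n^2)$.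 For a function $\varphi$, $\varphi'(x,h)=\lim_{t\to+0}(\varphi(x+th)-\varphi(x))/t$. Further: * $\Lambda(x_*)$ is the set of Lagrange multipliers at $x_*$, i.e. of all $\lambda\in Y^*$ such that $\langle\lambda,y\rangle\le0$ for all $y\in K$, $\langle\lambda,G(x_*)\rangle=0$, and $[F(\cdot)+\langle\lambda,G(\cdot)\rangle]'(x_*,h)\ge0$ for all $h\in T_A(x_*)$; * for $\lambda\in\Lambda(x_*)$, $\alpha(x_*,\lambda)$ is the set of Danskin–Demyanov multipliers, i.e. of all $\alpha\in\mathbb{R}^m$ such that $\alpha_i\ge0$, $\sum_i\alpha_i=1$, $\alpha_i=0$ whenever $f_i(x_*)\neq F(x_*)$, and $\big\langle\sum_i\alpha_i\nabla f_i(x_*),h\big\rangle+\langle\lambda,DG(x_*)h\rangle\ge0$ for all $h\in T_A(x_*)$; * $\mathcal L(x,\lambda,\alpha)=\sum_i\alpha_if_i(x)+\langle\lambda,G(x)\rangle$; * $C(x_*)=\{h\in T_A(x_*) : DG(x_*)h\in T_K(G(x_*)),\ F'(x_*,h)\le0\}$ is the critical cone; * $\sigma(\lambda,S)=\sup_{y\in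 S}\langle\lambda,y\rangle\in[-\infty,+\infty]$, with $\sigma(\lambda,\emptyset)=-\infty$. Then for every $h\in C(x_*)$ and every convex set $\mathcal T(h)\subseteq T^2_K(G(x_*),DG(x_*)h)$ one has $$\sup_{\lambda\in\Lambda(x_*)}\Big\{\sup_{\alpha\in\alpha(x_*,\lambda)}\big\langle h,\nabla^2_{xx}\mathcal L(x_*,\lambda,\alpha)h\big\rangle-\sigma(\lambda,\mathcal T(h))\Big\}\ge0,$$ the suprema being taken in the extended real line (with $\sup\emptyset=-\infty$). -/

import Mathlib

open Filter Topology Asymptotics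

namespace ConeMinimax

/-- The contingent (Bouligand tangent) cone to `C` at `x`. -/
def contingentCone {X : Type*} [NormedAddCommGroup X] [NormedSpace ℝ X]
    (C : Set X) (x : X) : Set X :=
  {h | ∃ (a : ℕ → ℝ) (u : ℕ → X), (∀ n, 0 < a n) ∧ Tendsto a atTop (𝓝 0) ∧
    Tendsto u atTop (𝓝 h) ∧ ∀ n, x + a n • u n ∈ C}

/-- The outer second order tangent set to `S` at `y` in the direction `h`. -/
def secondOrderTangentSet {Y : Type*} [NormedAddCommGroup Y] [NormedSpace ℝ Y]
    (S : Set Y) (y h : Y) : Set Y :=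
  {w | ∃ t : ℕ → ℝ, (∀ n, 0 < t n) ∧ Tendsto t atTop (𝓝 0) ∧
    (fun n => Metric.infDist (y + t n • h + ((1 / 2 : ℝ) * t n ^ 2) • w) S)
      =o[atTop] fun n => t n ^ 2}

/-- The support function of `S`, with values in the extended reals
(so it equals `⊥` when `S` is empty). -/
noncomputable def supportFunction {Y : Type*} [NormedAddCommGroup Y] [NormedSpace ℝ Y]
    (l : StrongDual ℝ Y) (S : Set Y) : EReal :=
  ⨆ y ∈ S, ((l y : ℝ) : EReal)

/-- The polar cone of `K`. -/
def polarCone {Y : Type*} [NormedAddCommGroup Y] [NormedSpace ℝ Y]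
    (K : Set Y) : Set (StrongDual ℝ Y) :=
  {l | ∀ y ∈ K, l y ≤ 0}

/-- The number `v` is the one-sided directional derivative
`lim_{t → +0} (φ (x + t h) - φ x) / t`. -/
def HasDirDeriv {X : Type*} [NormedAddCommGroup X] [NormedSpace ℝ X]
    (φ : X → ℝ) (x h : X) (v : ℝ) : Prop :=
  Tendsto (fun t : ℝ => (φ (x + t • h) - φ x) / t) (𝓝[>] 0) (𝓝 v)

/-- The objective function `F x = max_i f_i x` (used with `1 ≤ m`). -/
noncomputable def maxFun {X : Type*} {m : ℕ} (f : Fin m → X → ℝ) (x : X) : ℝ :=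
  ⨆ i, f i x

/-- The feasible region. -/
def feasibleSet {X Y : Type*} (A : Set X) (K : Set Y) (G : X → Y) : Set X :=
  {x | x ∈ A ∧ G x ∈ K}

/-- `x` is a locally optimal solution of: minimise `max_i f_i` subject to `G x ∈ K`, `x ∈ A`. -/
def IsLocalSolution {X Y : Type*} [TopologicalSpace X] {m : ℕ}
    (A : Set X) (K : Set Y) (f : Fin m → X → ℝ) (G : X → Y) (x : X) : Prop :=
  x ∈ feasibleSet A K G ∧ IsLocalMinOn (maxFun f) (feasibleSet A K G) x

section

variable {X Y : Type*} [NormedAddCommGroup X] [NormedSpace ℝ X]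
  [NormedAddCommGroup Y] [NormedSpace ℝ Y] {m : ℕ}

/-- Robinson's constraint qualification at `x`. -/
def RCQ (A : Set X) (K : Set Y) (G : X → Y) (x : X) : Prop :=
  (0 : Y) ∈ interior {y | ∃ a ∈ A, ∃ k ∈ K, y = G x + fderiv ℝ G x (a - x) - k}

/-- The Lagrangian `L(x, l) = F(x) + ⟨l, G(x)⟩`. -/
noncomputable def lagrangian (f : Fin m → X → ℝ) (G : X → Y) (x : X)
    (l : StrongDual ℝ Y) : ℝ :=
  maxFun f x + l (G x)

/-- The set of all Lagrange multipliers at `x`. -/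
def lagrangeMultipliers (A : Set X) (K : Set Y) (f : Fin m → X → ℝ) (G : X → Y) (x : X) :
    Set (StrongDual ℝ Y) :=
  {l | l ∈ polarCone K ∧ l (G x) = 0 ∧
    ∀ h ∈ contingentCone A x, ∃ v, HasDirDeriv (fun z => lagrangian f G z l) x h v ∧ 0 ≤ v}

/-- The critical cone at `x`. -/
def criticalCone (A : Set X) (K : Set Y) (f : Fin m → X → ℝ) (G : X → Y) (x : X) : Set X :=
  {h | h ∈ contingentCone A x ∧ fderiv ℝ G x h ∈ contingentCone K (G x) ∧
    ∃ v, HasDirDeriv (maxFun f) x h v ∧ v ≤ 0}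

/-- The set of all Danskin-Demyanov multipliers corresponding to `(x, l)`. A nonnegative measure
on the finite set of indices is identified with the vector `α` of its weights; its support lies
in the set of active indices, and its total mass is `1`. -/
def danskinDemyanovMultipliers (A : Set X) (f : Fin m → X → ℝ) (G : X → Y) (x : X)
    (l : StrongDual ℝ Y) : Set (Fin m → ℝ) :=
  {α | (∀ i, 0 ≤ α i) ∧ ∑ i, α i = 1 ∧ (∀ i, α i ≠ 0 → f i x = maxFun f x) ∧
    ∀ h ∈ contingentCone A x, 0 ≤ (∑ i, α i * fderiv ℝ (f i) x h) + l (fderiv ℝ G x h)}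

/-- The integral Lagrangian `(∑ i, α i * f_i(x)) + ⟨l, G(x)⟩`. -/
noncomputable def integralLagrangian (f : Fin m → X → ℝ) (G : X → Y) (x : X)
    (l : StrongDual ℝ Y) (α : Fin m → ℝ) : ℝ :=
  (∑ i, α i * f i x) + l (G x)

/-- The quadratic form `⟨h, ∇²_xx 𝓛(x, l, α) h⟩` of the Hessian of the integral Lagrangian. -/
noncomputable def hessianForm (f : Fin m → X → ℝ) (G : X → Y) (x : X)
    (l : StrongDual ℝ Y) (α : Fin m → ℝ) (h : X) : ℝ :=
  fderiv ℝ (fderiv ℝ fun z => integralLagrangian f G z l α) x h h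

end

end ConeMinimax

namespace ConeMinimax

/-! ### Robinson's condition and metric regularity. -/

section

variable {X Y : Type*} [NormedAddCommGroup X] [NormedSpace ℝ X]
  [NormedAddCommGroup Y] [NormedSpace ℝ Y]

/-! Move from `x` along the parabola `x + t h + t²w/2`. If `DG w + D²G(h,h)` is a second order
tangent, this curve misses the constraint `G ∈ K` by only `o(t²)` along some `t_n → 0`. Metric
regularity (`eventually_exists_mem_of_closedBall_subset`) repairs it by a shift of size `o(t²)`, and
interiority keeps it in `A`. So local optimality forbids that every active `f_i` decrease at order
`t²` or lower: `exists_active_nonneg_of_isLocalSolution`.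

This says that a convex system in `w` has no solution. Hahn–Banach separation in `Y × ℝ^m`
(`exists_multipliers_of_linearized`) yields `l` and `α`; Robinson's condition supplies the interior
point and excludes `α = 0`. Enlarging `T` by `K - ℝ₊ G x` forces `l ≤ 0` on `K` and `l (G x) = 0`.
One pair `(l, α)` bounds `l` on all of `T` by the Hessian form, so it alone makes the supremum
nonnegative. -/

theorem zero_mem_of_isClosed {K : ConvexCone ℝ Y} (hne : (K : Set Y).Nonempty)
    (hcl : IsClosed (K : Set Y)) : (0 : Y) ∈ K := by
  obtain ⟨k, hk⟩ := hne
  have h1 : Tendsto (fun n : ℕ => (1 / ((n : ℝ) + 1)) • k) atTop (𝓝 ((0 : ℝ) • k)) :=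
    tendsto_one_div_add_atTop_nhds_zero_nat.smul_const k
  rw [zero_smul] at h1
  exact hcl.mem_of_tendsto h1 (Eventually.of_forall fun n => K.smul_mem (by positivity) hk)

theorem smul_mem_of_isClosed {K : ConvexCone ℝ Y} (hcl : IsClosed (K : Set Y)) {c : ℝ}
    (hc : 0 ≤ c) {k : Y} (hk : k ∈ K) : c • k ∈ K := by
  rcases hc.eq_or_lt with rfl | hc
  · rw [zero_smul]
    exact zero_mem_of_isClosed ⟨k, hk⟩ hcl
  · exact K.smul_mem hc hk

/-- A neighbourhood of `0` is absorbing: `t • z` lies in it for small `t > 0`, and dividing by `t`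
gives the decomposition with `s = t⁻¹`. -/
theorem exists_decomposition_of_RCQ {A : Set X} {K : ConvexCone ℝ Y} {G : X → Y} {x : X}
    (hR : RCQ A (K : Set Y) G x) (z : Y) :
    ∃ w : X, ∃ s : ℝ, 0 ≤ s ∧ ∃ k ∈ K, z = fderiv ℝ G x w + s • G x - k := by
  have h1 : Tendsto (fun t : ℝ => t • z) (𝓝[>] 0) (𝓝 0) := by
    have : Tendsto (fun t : ℝ => t • z) (𝓝 0) (𝓝 ((0 : ℝ) • z)) :=
      tendsto_id.smul_const z
    rw [zero_smul] at this
    exact this.mono_left nhdsWithin_le_nhds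
  obtain ⟨t, ⟨a, -, k, hk, hz⟩, ht⟩ :=
    ((h1.eventually (mem_interior_iff_mem_nhds.1 hR)).and self_mem_nhdsWithin).exists
  have ht : 0 < t := ht
  refine ⟨t⁻¹ • (a - x), t⁻¹, by positivity, t⁻¹ • k, K.smul_mem (by positivity) hk, ?_⟩
  have : z = t⁻¹ • t • z := by rw [smul_smul, inv_mul_cancel₀ ht.ne', one_smul]
  rw [this, hz, map_smul]
  module

/-- Quantitative form of the constraint qualification: if `L X + ℝ₊ y - K` is the whole space and
`X` is finite dimensional, then `y + L B - K` contains a ball, `B` being the unit ball. -/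
theorem exists_closedBall_subset_of_decomposition [FiniteDimensional ℝ X] [CompleteSpace Y]
    {K : ConvexCone ℝ Y} (hcl : IsClosed (K : Set Y)) (L : X →L[ℝ] Y) {y : Y} (hy : y ∈ K)
    (hdec : ∀ z : Y, ∃ w : X, ∃ s : ℝ, 0 ≤ s ∧ ∃ k ∈ K, z = L w + s • y - k) :
    ∃ δ > 0, ∀ z : Y, ‖z‖ ≤ δ → ∃ w : X, ‖w‖ ≤ 1 ∧ ∃ k ∈ K, z = y + L w - k := by
  have : ProperSpace X := FiniteDimensional.proper ℝ X
  -- Baire category: each `C n` is a compact set plus the closed set `-K`, hence closed, and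
  -- together they cover `Y`.
  let C : ℕ → Set Y := fun n =>
    {z | ∃ w : X, ‖w‖ ≤ n ∧ ∃ s : ℝ, 0 ≤ s ∧ s ≤ n ∧ ∃ k ∈ K, z = L w + s • y - k}
  have hC : ∀ n, IsClosed (C n) := by
    intro n
    have hcomp : IsCompact ((fun p : X × ℝ => L p.1 + p.2 • y) ''
        (Metric.closedBall 0 n ×ˢ Set.Icc 0 (n : ℝ))) :=
      ((isCompact_closedBall _ _).prod isCompact_Icc).image (by fun_prop)
    have hneg : IsClosed (-(K : Set Y)) := hcl.neg
    have hsum := hneg.add_left_of_isCompact hcomp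
    convert hsum using 1
    ext z
    constructor
    · rintro ⟨w, hw, s, hs0, hs, k, hk, rfl⟩
      refine ⟨_, ⟨(w, s), ⟨by simpa using hw, hs0, hs⟩, rfl⟩, -k, by simpa using hk, ?_⟩
      exact (sub_eq_add_neg _ _).symm
    · rintro ⟨_, ⟨⟨w, s⟩, ⟨hw, hs0, hs⟩, rfl⟩, k, hk, rfl⟩
      exact ⟨w, by simpa using hw, s, hs0, hs, -k, hk, by simp⟩
  have hmono : ∀ z : Y, ∃ n, z ∈ C n := by
    intro z
    obtain ⟨w, s, hs, k, hk, hz⟩ := hdec z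
    obtain ⟨n, hn⟩ := exists_nat_ge (max ‖w‖ s)
    exact ⟨n, w, (le_max_left _ _).trans hn, s, hs, (le_max_right _ _).trans hn, k, hk, hz⟩
  obtain ⟨n, z₀, hz₀⟩ := nonempty_interior_of_iUnion_of_closed hC
    (Set.eq_univ_of_forall fun z => Set.mem_iUnion.2 (hmono z))
  obtain ⟨r, hr, hball⟩ := Metric.mem_nhds_iff.1 (mem_interior_iff_mem_nhds.1 hz₀)
  -- The ball is centred at `z₀`; a decomposition of `-z₀` recentres it at `0`.
  obtain ⟨n', w', hw', s', hs0', hs', k', hk', hz'⟩ := hmono (-z₀)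
  set N : ℝ := n + n' + 1 with hN
  have hNpos : 0 < N := by positivity
  refine ⟨r / (2 * N), by positivity, fun z hz => ?_⟩
  have hmem : z₀ + N • z ∈ C n := by
    apply hball
    rw [Metric.mem_ball, dist_eq_norm, add_sub_cancel_left, norm_smul, Real.norm_of_nonneg hNpos.le]
    calc N * ‖z‖ ≤ N * (r / (2 * N)) := by gcongr
      _ = r / 2 := by field_simp
      _ < r := by linarith
  obtain ⟨w, hw, s, hs0, hs, k, hk, hzk⟩ := hmem
  -- After division by `N` the coefficient of `y` is at most `1`; the part missing to `1` is moved
  -- into `K`.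
  refine ⟨N⁻¹ • (w + w'), ?_, N⁻¹ • (k + k') + (1 - N⁻¹ * (s + s')) • y,
    K.add_mem (K.smul_mem (by positivity) (K.add_mem hk hk')) (smul_mem_of_isClosed hcl ?_ hy), ?_⟩
  · rw [norm_smul, norm_inv, Real.norm_of_nonneg hNpos.le, inv_mul_le_iff₀ hNpos]
    linarith [norm_add_le w w']
  · rw [sub_nonneg, inv_mul_le_iff₀ hNpos]
    linarith
  · have h1 : N • z = L w + s • y - k + (L w' + s' • y - k') := by
      rw [← hzk, ← hz']; abel
    have h2 : z = N⁻¹ • N • z := by rw [smul_smul, inv_mul_cancel₀ hNpos.ne', one_smul]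
    rw [h2, h1, map_smul, map_add]
    module

/-- Metric regularity of the constraint `G x ∈ K`. -/
theorem eventually_exists_mem_of_closedBall_subset [FiniteDimensional ℝ X] {K : Set Y}
    (hcl : IsClosed K) (hconv : Convex ℝ K) {G : X → Y} {L : X →L[ℝ] Y} {x₀ : X}
    (hG : HasStrictFDerivAt G L x₀) (hx₀ : G x₀ ∈ K) {δ : ℝ} (hδ : 0 < δ)
    (hreg : ∀ z : Y, ‖z‖ ≤ δ → ∃ w : X, ‖w‖ ≤ 1 ∧ ∃ k ∈ K, z = G x₀ + L w - k) :
    ∃ c > 0, ∀ᶠ x in 𝓝 x₀, ∃ x', G x' ∈ K ∧ c * ‖x' - x‖ ≤ Metric.infDist (G x) K := by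
  have : ProperSpace X := FiniteDimensional.proper ℝ X
  have hne : K.Nonempty := ⟨_, hx₀⟩
  have hbound : ∀ᶠ p : X × X in 𝓝 (x₀, x₀),
      ‖G p.1 - G p.2 - L (p.1 - p.2)‖ ≤ δ / 8 * ‖p.1 - p.2‖ :=
    hG.isLittleO.def (by positivity)
  rw [nhds_prod_eq] at hbound
  obtain ⟨s, hs, hsb⟩ := (eventually_prod_self_iff
    (r := fun a b => ‖G a - G b - L (a - b)‖ ≤ δ / 8 * ‖a - b‖)).1 hbound
  have hcont : ∀ᶠ x in 𝓝 x₀, ‖G x - G x₀‖ ≤ δ / 16 := by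
    have := hG.hasFDerivAt.continuousAt.eventually (Metric.closedBall_mem_nhds (G x₀)
      (show 0 < δ / 16 by positivity))
    simpa [Metric.mem_closedBall, dist_eq_norm] using this
  obtain ⟨r, hr, hrs⟩ := Metric.nhds_basis_closedBall.mem_iff.1 (inter_mem hs hcont)
  have happ : ∀ a ∈ Metric.closedBall x₀ r, ∀ b ∈ Metric.closedBall x₀ r,
      ‖G a - G b - L (a - b)‖ ≤ δ / 8 * ‖a - b‖ :=
    fun a ha b hb => hsb a (hrs ha).1 b (hrs hb).1
  have hGcont : ContinuousOn G (Metric.closedBall x₀ r) := by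
    have hA : ApproximatesLinearOn G L (Metric.closedBall x₀ r) ⟨δ / 8, by positivity⟩ :=
      fun a ha b hb => happ a ha b hb
    exact hA.continuousOn
  refine ⟨δ / 4, by positivity, ?_⟩
  have hφ : ∀ᶠ x in 𝓝 x₀, Metric.infDist (G x) K < δ / 4 * (r / 4) := by
    have h1 : Tendsto (fun x => Metric.infDist (G x) K) (𝓝 x₀) (𝓝 (Metric.infDist (G x₀) K)) :=
      ((Metric.continuous_infDist_pt K).tendsto _).comp hG.hasFDerivAt.continuousAt
    rw [Metric.infDist_zero_of_mem hx₀] at h1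
    exact h1.eventually_lt_const (by positivity)
  filter_upwards [hφ, Metric.ball_mem_nhds x₀ (show 0 < r / 4 by positivity)] with x hx hxr
  rw [Metric.mem_ball, dist_eq_norm] at hxr
  -- Compactness plays the role of Ekeland's principle: at a penalised minimiser `x'`, if `G x' ∉
  -- K`, a short step would lower the distance to `K` faster than the penalty slope `δ / 4`.
  obtain ⟨x', hx'r, hmin⟩ := (isCompact_closedBall x₀ r).exists_isMinOn
    ⟨x₀, Metric.mem_closedBall_self hr.le⟩
    (f := fun z => Metric.infDist (G z) K + δ / 4 * ‖z - x‖)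
    (((Metric.continuous_infDist_pt K).comp_continuousOn hGcont).add (by fun_prop))
  have hmin' : ∀ z ∈ Metric.closedBall x₀ r, Metric.infDist (G x') K + δ / 4 * ‖x' - x‖ ≤
      Metric.infDist (G z) K + δ / 4 * ‖z - x‖ := fun z hz => hmin hz
  have h0 := hmin' x (by rw [Metric.mem_closedBall, dist_eq_norm]; linarith)
  rw [sub_self, norm_zero, mul_zero, add_zero] at h0
  have hnn : 0 ≤ Metric.infDist (G x') K := Metric.infDist_nonneg
  refine ⟨x', ?_, by linarith⟩
  have hxx' : ‖x' - x‖ < r / 4 := by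
    by_contra! hcon
    have : δ / 4 * (r / 4) ≤ δ / 4 * ‖x' - x‖ := by gcongr
    linarith
  have hx'half : ‖x' - x₀‖ ≤ r / 2 := by
    linarith [norm_sub_le_norm_sub_add_norm_sub x' x x₀]
  rw [hcl.mem_iff_infDist_zero hne]
  by_contra hcon
  set ρ := Metric.infDist (G x') K with hρ
  have hρpos : 0 < ρ := lt_of_le_of_ne hnn (Ne.symm hcon)
  have hGx' : ‖G x' - G x₀‖ ≤ δ / 16 := (hrs hx'r).2
  have hρle : ρ ≤ δ / 16 := by
    refine (Metric.infDist_le_dist_of_mem hx₀).trans ?_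
    rwa [dist_eq_norm]
  obtain ⟨t, ht, ht1, htr, htρ⟩ : ∃ t : ℝ, 0 < t ∧ t ≤ 1 ∧ t ≤ r / 2 ∧ t * δ ≤ ρ := by
    refine ⟨min 1 (min (r / 2) (ρ / δ)), by positivity, min_le_left _ _,
      (min_le_right _ _).trans (min_le_left _ _), ?_⟩
    rw [← le_div_iff₀ hδ]
    exact (min_le_right _ _).trans (min_le_right _ _)
  obtain ⟨k, hk, hyk⟩ := (Metric.infDist_lt_iff hne).1
    (show Metric.infDist (G x') K < ρ + t * δ / 16 by rw [← hρ]; linarith [mul_pos ht hδ])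
  have hNρ : ρ ≤ ‖G x' - k‖ := by
    rw [← dist_eq_norm]; exact Metric.infDist_le_dist_of_mem hk
  rw [dist_eq_norm] at hyk
  set N := ‖G x' - k‖ with hN
  have hNpos : 0 < N := by linarith
  -- The target has norm `δ` and points from `G x'` towards the nearly closest point `k`; a step `t
  -- • w` scales the residual `G x' - k` by `1 - t * (δ / N)`, up to small errors.
  obtain ⟨w, hw, k₁, hk₁, hz⟩ := hreg (-((δ / N) • (G x' - k))) (by
    rw [norm_neg, norm_smul, Real.norm_of_nonneg (by positivity), ← hN, div_mul_cancel₀ _ hNpos.ne'])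
  have htw : ‖t • w‖ ≤ t := by
    rw [norm_smul, Real.norm_of_nonneg ht.le]
    exact mul_le_of_le_one_right ht.le hw
  have hx''r : x' + t • w ∈ Metric.closedBall x₀ r := by
    rw [Metric.mem_closedBall, dist_eq_norm, add_sub_right_comm]
    linarith [norm_add_le (x' - x₀) (t • w)]
  have herr := happ _ hx''r _ hx'r
  rw [add_sub_cancel_left] at herr
  have hmem : (1 - t) • k + t • k₁ ∈ K := hconv hk hk₁ (by linarith) ht.le (by ring)
  have hLw : L w = k₁ - G x₀ - (δ / N) • (G x' - k) := by
    rw [sub_eq_add_neg _ ((δ / N) • (G x' - k)), hz]; abel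
  have hsplit : G (x' + t • w) - ((1 - t) • k + t • k₁) =
      (G (x' + t • w) - G x' - L (t • w)) + (1 - t * (δ / N)) • (G x' - k)
        + t • (k - G x₀) := by
    rw [map_smul, hLw]; module
  have hkx : ‖k - G x₀‖ ≤ N + δ / 16 := by
    have := norm_sub_le_norm_sub_add_norm_sub k (G x') (G x₀)
    rw [norm_sub_rev k (G x')] at this
    linarith
  have hcoef : ‖(1 - t * (δ / N)) • (G x' - k)‖ = N - t * δ := by
    have : t * (δ / N) ≤ 1 := by
      rw [← mul_div_assoc, div_le_one hNpos]; linarith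
    rw [norm_smul, Real.norm_of_nonneg (by linarith), ← hN]
    field_simp
  have hdist : Metric.infDist (G (x' + t • w)) K ≤ δ / 8 * t + (N - t * δ) + t * (3 * δ / 16) := by
    refine (Metric.infDist_le_dist_of_mem hmem).trans ?_
    rw [dist_eq_norm, hsplit]
    refine (norm_add₃_le).trans ?_
    rw [hcoef, norm_smul, Real.norm_of_nonneg ht.le]
    have h1 : ‖k - G x₀‖ ≤ 3 * δ / 16 := by
      have : t * δ ≤ δ := mul_le_of_le_one_left hδ.le ht1
      linarith
    have h2 : δ / 8 * ‖t • w‖ ≤ δ / 8 * t := by gcongr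
    have h3 : t * ‖k - G x₀‖ ≤ t * (3 * δ / 16) := by gcongr
    linarith
  have hfin := hmin' _ hx''r
  have htri : ‖x' + t • w - x‖ ≤ ‖x' - x‖ + t := by
    rw [add_sub_right_comm]
    linarith [norm_add_le (x' - x) (t • w)]
  have : δ / 4 * ‖x' + t • w - x‖ ≤ δ / 4 * (‖x' - x‖ + t) := by gcongr
  have := mul_pos ht hδ
  linarith

end

/-! ### Second order expansions and directional derivatives. -/

theorem le_maxFun {X : Type*} {m : ℕ} (f : Fin m → X → ℝ) (i : Fin m) (x : X) : f i x ≤ maxFun f x :=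
  le_ciSup (f := fun i => f i x) (Set.finite_range _).bddAbove i

section

variable {X Y : Type*} [NormedAddCommGroup X] [NormedSpace ℝ X]
  [NormedAddCommGroup Y] [NormedSpace ℝ Y] {m : ℕ}

/-- Mean value inequality on the ball of radius `|t|`, where `g'` is bounded by `ε * |t|`. -/
theorem isLittleO_sq_of_hasDerivAt {g g' : ℝ → Y} (hg : ∀ᶠ t in 𝓝 0, HasDerivAt g (g' t) t)
    (h0 : g 0 = 0) (hg' : g' =o[𝓝 0] fun t => t) : g =o[𝓝 0] fun t => t ^ 2 := by
  refine IsLittleO.of_bound fun ε hε => ?_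
  obtain ⟨r, hr, hball⟩ := Metric.eventually_nhds_iff_ball.1 (hg.and (hg'.def hε))
  filter_upwards [Metric.ball_mem_nhds (0 : ℝ) hr] with t ht
  have hsub : Metric.closedBall (0 : ℝ) |t| ⊆ Metric.ball 0 r :=
    Metric.closedBall_subset_ball (by simpa using ht)
  have h1 := (convex_closedBall (0 : ℝ) |t|).norm_image_sub_le_of_norm_hasDerivWithin_le
    (f := g) (f' := g') (C := ε * |t|) (x := 0) (y := t)
    (fun s hs => (hball s (hsub hs)).1.hasDerivWithinAt)
    (fun s hs => (hball s (hsub hs)).2.trans (by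
      have : ‖s‖ ≤ |t| := by simpa using hs
      gcongr))
    (by simp) (by simp)
  rw [h0, sub_zero, sub_zero] at h1
  rw [norm_pow, Real.norm_eq_abs]
  calc ‖g t‖ ≤ ε * |t| * ‖t‖ := h1
    _ = ε * |t| ^ 2 := by rw [Real.norm_eq_abs]; ring

theorem hasDerivAt_parabola (x h w : X) (t : ℝ) :
    HasDerivAt (fun t : ℝ => x + t • h + ((1 / 2 : ℝ) * t ^ 2) • w) (h + t • w) t := by
  have h1 : HasDerivAt (fun t : ℝ => t • h) h t := by
    simpa using (hasDerivAt_id t).smul_const h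
  have h2 : HasDerivAt (fun t : ℝ => ((1 / 2 : ℝ) * t ^ 2) • w) (t • w) t := by
    have : HasDerivAt (fun t : ℝ => (1 / 2 : ℝ) * t ^ 2) t t := by
      have h3 := (hasDerivAt_pow 2 t).const_mul (1 / 2 : ℝ)
      rwa [show (1 / 2 : ℝ) * ((2 : ℕ) * t ^ (2 - 1)) = t by norm_num; ring] at h3
    exact this.smul_const w
  exact (h1.const_add x).add h2

theorem tendsto_parabola (x h w : X) :
    Tendsto (fun t : ℝ => x + t • h + ((1 / 2 : ℝ) * t ^ 2) • w) (𝓝 0) (𝓝 x) := by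
  have := (hasDerivAt_parabola x h w 0).continuousAt.tendsto
  simpa using this

theorem eventually_differentiableAt {f : X → Y} {x : X} (hf : ContDiffAt ℝ 2 f x) :
    ∀ᶠ z in 𝓝 x, DifferentiableAt ℝ f z :=
  (hf.eventually (by simp)).mono fun _ hz => hz.differentiableAt (by simp)

theorem hasFDerivAt_fderiv_of_contDiffAt {f : X → Y} {x : X} (hf : ContDiffAt ℝ 2 f x) :
    HasFDerivAt (fderiv ℝ f) (fderiv ℝ (fderiv ℝ f) x) x :=
  ((hf.fderiv_right (m := 1) (by norm_num)).differentiableAt (by simp)).hasFDerivAt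

/-- Second order expansion of a `C²` map along a parabola. -/
theorem isLittleO_parabola {f : X → Y} {x : X} (hf : ContDiffAt ℝ 2 f x) (h w : X) :
    (fun t : ℝ => f (x + t • h + ((1 / 2 : ℝ) * t ^ 2) • w) -
      (f x + t • fderiv ℝ f x h +
        ((1 / 2 : ℝ) * t ^ 2) • (fderiv ℝ f x w + fderiv ℝ (fderiv ℝ f) x h h)))
      =o[𝓝 0] fun t => t ^ 2 := by
  set γ : ℝ → X := fun t => x + t • h + ((1 / 2 : ℝ) * t ^ 2) • w with hγ
  have hγ0 : γ 0 = x := by simp [hγ]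
  apply isLittleO_sq_of_hasDerivAt (g' := fun t => fderiv ℝ f (γ t) (h + t • w) -
    (fderiv ℝ f x h + t • (fderiv ℝ f x w + fderiv ℝ (fderiv ℝ f) x h h)))
  · filter_upwards [(tendsto_parabola x h w).eventually (eventually_differentiableAt hf)] with t ht
    exact (ht.hasFDerivAt.comp_hasDerivAt t (hasDerivAt_parabola x h w t)).sub
      (hasDerivAt_parabola _ _ _ t)
  · simp
  · have h1 : HasDerivAt (fun t : ℝ => fderiv ℝ f (γ t))
        (fderiv ℝ (fderiv ℝ f) x (h + (0 : ℝ) • w)) 0 := by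
      apply HasFDerivAt.comp_hasDerivAt (0 : ℝ) _ (hasDerivAt_parabola x h w 0)
      change HasFDerivAt _ _ (γ 0)
      rw [hγ0]
      exact hasFDerivAt_fderiv_of_contDiffAt hf
    have h2 : HasDerivAt (fun t : ℝ => h + t • w) w 0 := by
      simpa using ((hasDerivAt_id (0 : ℝ)).smul_const w).const_add h
    have h3 := hasDerivAt_iff_isLittleO.1 (h1.clm_apply h2)
    simp only [hγ0, zero_smul, add_zero, sub_zero] at h3
    refine h3.congr_left fun t => ?_
    rw [add_comm (fderiv ℝ f x w), sub_sub]

/-- The quadratic drop comes from a positive gap if `f x < M`, from a negative slope if there is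
one, and otherwise from the second order term. -/
theorem exists_tendsto_parabola_le {f : X → ℝ} {x : X} (hf : ContDiffAt ℝ 2 f x) {h w : X}
    {M : ℝ} (hx : f x ≤ M) (h1 : f x = M → fderiv ℝ f x h ≤ 0)
    (h2 : f x = M → 0 ≤ fderiv ℝ f x h →
      fderiv ℝ f x w + fderiv ℝ (fderiv ℝ f) x h h < 0) :
    ∃ c > 0, ∀ᶠ t : ℝ in 𝓝[>] 0,
      f (x + t • h + ((1 / 2 : ℝ) * t ^ 2) • w) ≤ M - c * t ^ 2 := by
  have hT := isLittleO_parabola hf h w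
  set p := fderiv ℝ f x h
  set q := fderiv ℝ f x w + fderiv ℝ (fderiv ℝ f) x h h
  -- The second `c` is spare, to absorb the `o(t²)` Taylor remainder.
  obtain ⟨c, hc, hev⟩ : ∃ c > 0, ∀ᶠ t : ℝ in 𝓝[>] 0,
      f x + t * p + 1 / 2 * t ^ 2 * q ≤ M - (c + c) * t ^ 2 := by
    have hlim : ∀ a b c : ℝ, Tendsto (fun t : ℝ => a + t * b + t ^ 2 * c) (𝓝[>] 0) (𝓝 a) := by
      intro a b c
      have : Continuous (fun t : ℝ => a + t * b + t ^ 2 * c) := by fun_prop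
      simpa using (this.tendsto 0).mono_left nhdsWithin_le_nhds
    rcases hx.lt_or_eq with hlt | heq
    · refine ⟨1, one_pos, ?_⟩
      filter_upwards [(hlim (f x) p (1 / 2 * q + 2)).eventually_le_const hlt] with t ht
      linarith
    · rcases (h1 heq).lt_or_eq with hp | hp
      · refine ⟨1, one_pos, ?_⟩
        filter_upwards [(hlim p (1 / 2 * q + 2) 0).eventually_le_const hp, self_mem_nhdsWithin]
          with t ht ht0
        have ht0 : 0 < t := ht0
        have := mul_nonpos_of_nonneg_of_nonpos ht0.le ht
        nlinarith
      · refine ⟨-q / 4, by linarith [h2 heq hp.ge], Eventually.of_forall fun t => ?_⟩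
        rw [hp, heq]
        linarith
  refine ⟨c, hc, ?_⟩
  filter_upwards [hev, (hT.def hc).filter_mono nhdsWithin_le_nhds] with t ht ht'
  rw [Real.norm_eq_abs, Real.norm_of_nonneg (sq_nonneg t)] at ht'
  have := (abs_le.1 ht').2
  simp only [smul_eq_mul] at this
  linarith

theorem tendsto_slope_of_differentiableAt {φ : X → ℝ} {x : X} (hφ : DifferentiableAt ℝ φ x)
    (h : X) : HasDirDeriv φ x h (fderiv ℝ φ x h) := by
  have h1 := (hφ.hasFDerivAt.hasLineDerivAt h).tendsto_slope_zero_right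
  refine h1.congr fun t => ?_
  rw [smul_eq_mul, div_eq_inv_mul]

theorem fderiv_le_of_hasDirDeriv_maxFun {f : Fin m → X → ℝ} {x h : X} {v : ℝ} {i : Fin m}
    (hf : DifferentiableAt ℝ (f i) x) (hi : f i x = maxFun f x)
    (hv : HasDirDeriv (maxFun f) x h v) : fderiv ℝ (f i) x h ≤ v := by
  refine le_of_tendsto_of_tendsto (tendsto_slope_of_differentiableAt hf h) hv ?_
  filter_upwards [self_mem_nhdsWithin] with t ht
  have ht : 0 < t := ht
  rw [hi]
  gcongr
  exact le_maxFun f i _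

/-- Danskin's formula for the directional derivative of a finite maximum. -/
theorem exists_hasDirDeriv_maxFun (hm : 1 ≤ m) {f : Fin m → X → ℝ} {x : X}
    (hf : ∀ i, DifferentiableAt ℝ (f i) x) (h : X) :
    ∃ v, HasDirDeriv (maxFun f) x h v ∧ ∀ i, f i x = maxFun f x → fderiv ℝ (f i) x h ≤ v := by
  have : Nonempty (Fin m) := ⟨⟨0, hm⟩⟩
  set I : Finset (Fin m) := Finset.univ.filter fun i => f i x = maxFun f x with hI
  have hmemI : ∀ i, i ∈ I ↔ f i x = maxFun f x := by simp [hI]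
  have hIne : I.Nonempty := by
    obtain ⟨i, hi⟩ := exists_eq_ciSup_of_finite (f := fun i => f i x)
    exact ⟨i, (hmemI i).2 hi⟩
  have key : HasDirDeriv (maxFun f) x h (I.sup' hIne fun i => fderiv ℝ (f i) x h) := by
    have h1 : Tendsto (fun t : ℝ => I.sup' hIne fun i => (f i (x + t • h) - f i x) / t) (𝓝[>] 0)
        (𝓝 (I.sup' hIne fun i => fderiv ℝ (f i) x h)) :=
      Tendsto.finset_sup'_nhds_apply hIne fun i _ => tendsto_slope_of_differentiableAt (hf i) h
    refine h1.congr' ?_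
    have hlim : ∀ i, Tendsto (fun t : ℝ => f i (x + t • h)) (𝓝[>] 0) (𝓝 (f i x)) := by
      intro i
      have h2 : Tendsto (fun t : ℝ => x + t • h) (𝓝 0) (𝓝 x) := by
        have : Continuous (fun t : ℝ => x + t • h) := by fun_prop
        simpa using this.tendsto 0
      exact ((hf i).continuousAt.tendsto.comp h2).mono_left nhdsWithin_le_nhds
    obtain ⟨j, hj⟩ := hIne
    have hev : ∀ᶠ t : ℝ in 𝓝[>] 0, ∀ i, i ∉ I → f i (x + t • h) < f j (x + t • h) := by
      rw [eventually_all]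
      intro i
      by_cases hi : i ∈ I
      · exact Eventually.of_forall fun t ht => absurd hi ht
      · have : f i x < f j x := by
          rw [(hmemI j).1 hj]
          exact (le_maxFun f i x).lt_of_ne fun h => hi ((hmemI i).2 h)
        exact ((hlim i).eventually_lt (hlim j) this).mono fun t ht _ => ht
    filter_upwards [hev, self_mem_nhdsWithin] with t ht ht0
    have ht0 : 0 < t := ht0
    apply le_antisymm
    · refine Finset.sup'_le _ _ fun i hi => ?_
      rw [(hmemI i).1 hi]
      gcongr
      exact le_maxFun f i _
    · rw [div_le_iff₀ ht0, sub_le_iff_le_add]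
      have hactive : ∀ i ∈ I, f i (x + t • h) ≤
          (I.sup' ⟨j, hj⟩ fun i => (f i (x + t • h) - f i x) / t) * t + maxFun f x := by
        intro i hi
        have := Finset.le_sup' (fun i => (f i (x + t • h) - f i x) / t) hi
        rw [div_le_iff₀ ht0, sub_le_iff_le_add, (hmemI i).1 hi] at this
        exact this
      refine ciSup_le fun i => ?_
      by_cases hi : i ∈ I
      · exact hactive i hi
      · exact (ht i hi).le.trans (hactive j hj)
  exact ⟨_, key, fun i hi =>
    Finset.le_sup' (fun i => fderiv ℝ (f i) x h) ((hmemI i).2 hi)⟩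

/-! ### Second order tangents and the primal condition. -/

/-- Compare with `(1 - a * s) • k' + a • k ∈ K` for `k' ∈ K`. The extra error carries the factor `‖z
- y‖`, which vanishes as `z → y`; the factor `2` is slack. -/
theorem infDist_add_smul_sub_le {K : ConvexCone ℝ Y} (hcl : IsClosed (K : Set Y)) {y k : Y}
    (hy : y ∈ K) (hk : k ∈ K) {s a : ℝ} (hs : 0 ≤ s) (ha : 0 ≤ a) (has : a * s ≤ 1) (z : Y) :
    Metric.infDist (z + a • (k - s • y)) (K : Set Y) ≤
      2 * Metric.infDist z (K : Set Y) + a * (s * ‖z - y‖) := by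
  have hne : (K : Set Y).Nonempty := ⟨y, hy⟩
  have key : ∀ k' ∈ (K : Set Y), Metric.infDist (z + a • (k - s • y)) (K : Set Y) ≤
      2 * dist z k' + a * (s * ‖z - y‖) := by
    intro k' hk'
    have hmem : (1 - a * s) • k' + a • k ∈ (K : Set Y) :=
      K.add_mem (smul_mem_of_isClosed hcl (by linarith) hk') (smul_mem_of_isClosed hcl ha hk)
    refine (Metric.infDist_le_dist_of_mem hmem).trans ?_
    have hrw : z + a • (k - s • y) - ((1 - a * s) • k' + a • k) =
        (1 - a * s) • (z - k') + (a * s) • (z - y) := by module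
    rw [dist_eq_norm, dist_eq_norm, hrw]
    refine (norm_add_le _ _).trans ?_
    have has0 : 0 ≤ a * s := mul_nonneg ha hs
    rw [norm_smul, norm_smul, Real.norm_of_nonneg has0, Real.norm_of_nonneg (by linarith)]
    nlinarith [norm_nonneg (z - k')]
  have : (Metric.infDist (z + a • (k - s • y)) (K : Set Y) - a * (s * ‖z - y‖)) / 2 ≤
      Metric.infDist z (K : Set Y) := by
    rw [Metric.le_infDist hne]
    intro k' hk'
    linarith [key k' hk']
  linarith

/-- Shifting by `k - s • y` costs `t² / 2` times a quantity tending to `0`. This invariance later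
gives the sign of `l` on `K` and complementarity. -/
theorem add_sub_smul_mem_secondOrderTangentSet {K : ConvexCone ℝ Y}
    (hcl : IsClosed (K : Set Y)) {y v w k : Y} (hy : y ∈ K)
    (hw : w ∈ secondOrderTangentSet (K : Set Y) y v) (hk : k ∈ K) {s : ℝ} (hs : 0 ≤ s) :
    w + (k - s • y) ∈ secondOrderTangentSet (K : Set Y) y v := by
  obtain ⟨t, ht0, ht, hlo⟩ := hw
  refine ⟨t, ht0, ht, ?_⟩
  have hzlim : Tendsto (fun n => s * ‖y + t n • v + ((1 / 2 : ℝ) * t n ^ 2) • w - y‖) atTop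
      (𝓝 0) := by
    have h1 := ((tendsto_parabola y v w).comp ht).sub_const y
    simpa using (h1.norm.const_mul s)
  have h2 : (fun n => (1 / 2 : ℝ) * t n ^ 2 *
      (s * ‖y + t n • v + ((1 / 2 : ℝ) * t n ^ 2) • w - y‖)) =o[atTop] fun n => t n ^ 2 := by
    have h3 : (fun n => (1 / 2 : ℝ) * t n ^ 2) =O[atTop] fun n => t n ^ 2 :=
      isBigO_const_mul_self _ _ _
    simpa using h3.mul_isLittleO ((isLittleO_one_iff ℝ).2 hzlim)
  refine IsBigO.trans_isLittleO ?_ ((hlo.const_mul_left 2).add h2)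
  refine IsBigO.of_bound 1 ?_
  have hsmall : Tendsto (fun n => (1 / 2 : ℝ) * t n ^ 2 * s) atTop (𝓝 0) := by
    simpa using ((ht.pow 2).const_mul (1 / 2 : ℝ)).mul_const s
  filter_upwards [hsmall.eventually_le_const one_pos] with n hn
  rw [one_mul, Real.norm_of_nonneg Metric.infDist_nonneg, smul_add, ← add_assoc]
  exact (infDist_add_smul_sub_le hcl hy hk hs (by positivity) hn _).trans (le_abs_self _)

/-- Primal second order necessary condition. -/
theorem exists_active_nonneg_of_isLocalSolution [FiniteDimensional ℝ X] (hm : 1 ≤ m) {A : Set X}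
    {K : Set Y} (hcl : IsClosed K) (hconv : Convex ℝ K) {f : Fin m → X → ℝ} {G : X → Y} {x : X}
    (hf : ∀ i, ContDiffAt ℝ 2 (f i) x) (hG : ContDiffAt ℝ 2 G x) (hxA : x ∈ interior A)
    (hloc : IsLocalSolution A K f G x) {δ : ℝ} (hδ : 0 < δ)
    (hreg : ∀ z : Y, ‖z‖ ≤ δ → ∃ w : X, ‖w‖ ≤ 1 ∧ ∃ k ∈ K, z = G x + fderiv ℝ G x w - k)
    {h w : X} (hh : ∀ i, f i x = maxFun f x → fderiv ℝ (f i) x h ≤ 0)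
    (hw : fderiv ℝ G x w + fderiv ℝ (fderiv ℝ G) x h h ∈
      secondOrderTangentSet K (G x) (fderiv ℝ G x h)) :
    ∃ i, f i x = maxFun f x ∧ 0 ≤ fderiv ℝ (f i) x h ∧
      0 ≤ fderiv ℝ (f i) x w + fderiv ℝ (fderiv ℝ (f i)) x h h := by
  have : Nonempty (Fin m) := ⟨⟨0, hm⟩⟩
  -- Otherwise every `f i` lies below `maxFun f x - c i * t ^ 2` along the parabola.
  by_contra! hcon
  choose c hc hcev using fun i => exists_tendsto_parabola_le (w := w) (hf i) (le_maxFun f i x)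
    (hh i) (hcon i)
  obtain ⟨t, ht0, ht, hlo⟩ := hw
  have htpos : Tendsto t atTop (𝓝[>] 0) :=
    tendsto_nhdsWithin_iff.2 ⟨ht, Eventually.of_forall ht0⟩
  set ξ : ℕ → X := fun n => x + t n • h + ((1 / 2 : ℝ) * t n ^ 2) • w with hξ
  have hξlim : Tendsto ξ atTop (𝓝 x) := (tendsto_parabola x h w).comp ht
  have hdist : (fun n => Metric.infDist (G (ξ n)) K) =o[atTop] fun n => t n ^ 2 := by
    have h1 := (isLittleO_parabola hG h w).comp_tendsto ht
    refine IsBigO.trans_isLittleO ?_ (hlo.add h1.norm_left)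
    refine IsBigO.of_bound 1 (Eventually.of_forall fun n => ?_)
    rw [one_mul, Real.norm_of_nonneg Metric.infDist_nonneg]
    refine (Metric.infDist_le_infDist_add_dist (y := G x + t n • fderiv ℝ G x h +
      ((1 / 2 : ℝ) * t n ^ 2) • (fderiv ℝ G x w + fderiv ℝ (fderiv ℝ G) x h h))).trans ?_
    rw [dist_eq_norm]
    exact le_abs_self _
  obtain ⟨κ, hκ, hmr⟩ := eventually_exists_mem_of_closedBall_subset hcl hconv
    (hG.hasStrictFDerivAt (by simp)) hloc.1.2 hδ hreg
  have hfeas : ∀ᶠ n in atTop, ∃ x', G x' ∈ K ∧ κ * ‖x' - ξ n‖ ≤ Metric.infDist (G (ξ n)) K :=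
    hξlim.eventually hmr
  choose! η hηK hη using fun n (hn : ∃ x', G x' ∈ K ∧
    κ * ‖x' - ξ n‖ ≤ Metric.infDist (G (ξ n)) K) => hn
  have hηξ : (fun n => η n - ξ n) =o[atTop] fun n => t n ^ 2 := by
    refine IsBigO.trans_isLittleO (IsBigO.of_bound κ⁻¹ ?_) hdist
    filter_upwards [hfeas] with n hn
    rw [Real.norm_of_nonneg Metric.infDist_nonneg, ← div_eq_inv_mul, le_div_iff₀ hκ, mul_comm]
    exact hη n hn
  have hηlim : Tendsto η atTop (𝓝 x) := by
    have h1 : Tendsto (fun n => t n ^ 2) atTop (𝓝 0) := by simpa using ht.pow 2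
    simpa using (hηξ.trans_tendsto h1).add hξlim
  -- `f i` is Lipschitz near `x`, so the `o(t²)` shift from `ξ` to the repaired point `η` uses up at
  -- most half of the drop.
  have hlt : ∀ i, ∀ᶠ n in atTop, f i (η n) < maxFun f x := by
    intro i
    have h1 : (fun n => f i (η n) - f i (ξ n)) =o[atTop] fun n => t n ^ 2 := by
      obtain ⟨M, s, hs, hLip⟩ := ((hf i).hasStrictFDerivAt (by simp)).exists_lipschitzOnWith
      refine IsBigO.trans_isLittleO (IsBigO.of_bound M ?_) hηξ
      filter_upwards [hηlim.eventually hs, hξlim.eventually hs] with n h1 h2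
      exact hLip.norm_sub_le h1 h2
    filter_upwards [h1.def (half_pos (hc i)), htpos.eventually (hcev i)] with n h2 h3
    have h4 : 0 < c i * t n ^ 2 := mul_pos (hc i) (pow_pos (ht0 n) 2)
    rw [Real.norm_of_nonneg (sq_nonneg (t n))] at h2
    have h5 := (le_abs_self _).trans h2
    have h6 : f i (ξ n) ≤ maxFun f x - c i * t n ^ 2 := h3
    linarith
  have hmin : ∀ᶠ n in atTop, η n ∈ feasibleSet A K G → maxFun f x ≤ maxFun f (η n) :=
    hηlim.eventually (eventually_nhdsWithin_iff.1 hloc.2)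
  obtain ⟨n, hn1, hn2, hn3, hn4⟩ := (hfeas.and ((eventually_all.2 hlt).and
    (hmin.and (hηlim.eventually (mem_interior_iff_mem_nhds.1 hxA))))).exists
  obtain ⟨i, hi⟩ := exists_eq_ciSup_of_finite (f := fun i => f i (η n))
  have h1 : f i (η n) = maxFun f (η n) := hi
  exact absurd (hn3 ⟨hn4, hηK n hn1⟩) (not_le.2 (h1 ▸ hn2 i))

end

/-! ### Separation and multipliers. -/

section

variable {X Y : Type*} [NormedAddCommGroup X] [NormedSpace ℝ X]
  [NormedAddCommGroup Y] [NormedSpace ℝ Y] {m : ℕ}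

/-- Duality for the linearised problem. -/
theorem exists_multipliers_of_linearized {K : ConvexCone ℝ Y} (hcl : IsClosed (K : Set Y))
    {L : X →L[ℝ] Y} {y : Y} (hy : y ∈ K) {δ : ℝ} (hδ : 0 < δ)
    (hreg : ∀ z : Y, ‖z‖ ≤ δ → ∃ w : X, ‖w‖ ≤ 1 ∧ ∃ k ∈ K, z = y + L w - k)
    {T : Set Y} (hT : Convex ℝ T) (hTne : T.Nonempty) (b : Y) (I : Set (Fin m))
    (g : Fin m → X →L[ℝ] ℝ) (β : Fin m → ℝ)
    (hval : ∀ w : X, ∀ τ ∈ T, ∀ k ∈ K, ∀ s : ℝ, 0 ≤ s → L w + b = τ + (k - s • y) →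
      ∃ i ∈ I, 0 ≤ g i w + β i) :
    ∃ (l : StrongDual ℝ Y) (α : Fin m → ℝ), (∀ i, 0 ≤ α i) ∧ ∑ i, α i = 1 ∧
      (∀ i, α i ≠ 0 → i ∈ I) ∧ (∀ k ∈ K, l k ≤ 0) ∧ l y = 0 ∧
      (∀ w, ∑ i, α i * g i w + l (L w) = 0) ∧ ∀ τ ∈ T, l τ ≤ ∑ i, α i * β i + l b := by
  -- Constraint residuals paired with strict upper bounds on the `g i w + β i`, `i ∈ I`; `hval` says
  -- exactly that `0 ∉ E`.
  set E : Set (Y × (Fin m → ℝ)) := {p | ∃ w : X, ∃ τ ∈ T, ∃ k ∈ K, ∃ s : ℝ, 0 ≤ s ∧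
    p.1 = L w + b - τ - (k - s • y) ∧ ∀ i ∈ I, g i w + β i < p.2 i} with hE
  have hEconv : Convex ℝ E := by
    rintro ⟨z, r⟩ ⟨w, τ, hτ, k, hk, s, hs, hz, hr⟩ ⟨z', r'⟩ ⟨w', τ', hτ', k', hk', s', hs', hz', hr'⟩
      a a' ha ha' haa
    refine ⟨a • w + a' • w', a • τ + a' • τ', hT hτ hτ' ha ha' haa, a • k + a' • k',
      K.add_mem (smul_mem_of_isClosed hcl ha hk) (smul_mem_of_isClosed hcl ha' hk'),
      a * s + a' * s', by positivity, ?_, fun i hi => ?_⟩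
    · have hb : b = a • b + a' • b := by rw [← add_smul, haa, one_smul]
      simp only at hz hz'
      simp only [Prod.fst_add, Prod.smul_fst, map_add, map_smul, hz, hz']
      nth_rw 3 [hb]
      module
    · have h1 := hr i hi
      have h2 := hr' i hi
      simp only [Prod.snd_add, Prod.smul_snd, map_add, map_smul, Pi.add_apply, Pi.smul_apply,
        smul_eq_mul] at h1 h2 ⊢
      have h3 : β i = a * β i + a' * β i := by rw [← add_mul, haa, one_mul]
      have h4 : a * g i w + a' * g i w' + β i = a * (g i w + β i) + a' * (g i w' + β i) := by
        linarith
      rw [h4]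
      rcases ha.eq_or_lt with rfl | ha
      · rw [zero_add] at haa
        subst haa
        linarith
      · have := mul_lt_mul_of_pos_left h1 ha
        have := mul_le_mul_of_nonneg_left h2.le ha'
        linarith
  have h0 : (0 : Y × (Fin m → ℝ)) ∉ E := by
    rintro ⟨w, τ, hτ, k, hk, s, hs, hz, hr⟩
    obtain ⟨i, hi, h1⟩ := hval w τ hτ k hk s hs (by
      have hz : 0 = L w + b - τ - (k - s • y) := hz
      rw [sub_sub, eq_comm, sub_eq_zero] at hz
      exact hz)
    have := hr i hi
    simp only [Prod.snd_zero, Pi.zero_apply] at this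
    linarith
  obtain ⟨τ₀, hτ₀⟩ := hTne
  have hint : (interior E).Nonempty := by
    obtain ⟨R, hR⟩ := Finite.bddAbove_range fun i => ‖g i‖ + β i
    -- `hreg` covers a ball of residuals with `‖w‖ ≤ 1` and `s = 1`, and `R` bounds every `g i w + β
    -- i` for such `w`.
    refine ⟨(b - τ₀, fun _ => R + 1), mem_interior_iff_mem_nhds.2 ?_⟩
    have h1 : ∀ᶠ z in 𝓝 (b - τ₀), ‖z - (b - τ₀)‖ ≤ δ := by
      filter_upwards [Metric.closedBall_mem_nhds (b - τ₀) hδ] with z hz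
      rwa [← dist_eq_norm]
    have h2 : ∀ᶠ r in 𝓝 (fun _ : Fin m => R + 1), ∀ i, R < r i := by
      rw [eventually_all]
      intro i
      exact ((continuous_apply i).tendsto _).eventually_const_lt (lt_add_one R)
    filter_upwards [h1.prod_nhds h2] with p hp
    obtain ⟨w, hw, k, hk, hz⟩ := hreg _ hp.1
    refine ⟨w, τ₀, hτ₀, k, hk, 1, zero_le_one, ?_, fun i _ => ?_⟩
    · rw [sub_eq_iff_eq_add] at hz
      rw [hz]
      module
    · have h3 : g i w ≤ ‖g i‖ := (le_abs_self _).trans ((g i).unit_le_opNorm w hw)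
      have h4 : ‖g i‖ + β i ≤ R := hR ⟨i, rfl⟩
      linarith [hp.2 i]
  obtain ⟨φ, hφ⟩ := geometric_hahn_banach_point_open hEconv.interior isOpen_interior
    fun h => h0 (interior_subset h)
  rw [map_zero] at hφ
  have hφE : ∀ p ∈ E, 0 ≤ φ p := by
    intro p hp
    have h1 : p ∈ closure (interior E) := by
      rw [hEconv.closure_interior_eq_closure_of_nonempty_interior hint]
      exact subset_closure hp
    exact closure_minimal (fun q hq => (hφ q hq).le)
      (isClosed_Ici.preimage φ.continuous) h1
  set l : StrongDual ℝ Y := φ.comp (ContinuousLinearMap.inl ℝ Y (Fin m → ℝ)) with hl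
  set α : Fin m → ℝ := fun i => φ (0, Pi.single i 1) with hα
  have hφeq : ∀ z r, φ (z, r) = l z + ∑ i, α i * r i := by
    intro z r
    have h1 : (z, r) = (z, 0) + ∑ i, r i • ((0 : Y), (Pi.single i 1 : Fin m → ℝ)) := by
      ext j
      · simp [Prod.fst_sum]
      · simp [Prod.snd_sum, Finset.sum_apply, Pi.single_apply]
    rw [h1, map_add, map_sum]
    congr 1
    exact Finset.sum_congr rfl fun i _ => by rw [map_smul, smul_eq_mul, mul_comm]
  have hK0 : (0 : Y) ∈ K := zero_mem_of_isClosed ⟨y, hy⟩ hcl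
  have hmain : ∀ w, ∀ τ ∈ T, ∀ k ∈ K, ∀ s : ℝ, 0 ≤ s → ∀ r : Fin m → ℝ, (∀ i ∈ I, 0 < r i) →
      0 ≤ l (L w) + l b - l τ - (l k - s * l y) + (∑ i, α i * g i w + ∑ i, α i * β i)
        + ∑ i, α i * r i := by
    intro w τ hτ k hk s hs r hr
    have h1 := hφE (L w + b - τ - (k - s • y), fun i => g i w + β i + r i)
      ⟨w, τ, hτ, k, hk, s, hs, rfl, fun i hi => by simpa using hr i hi⟩
    rw [hφeq] at h1
    simpa only [map_sub, map_add, map_smul, smul_eq_mul, mul_add, Finset.sum_add_distrib,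
      add_assoc] using h1
  -- Most sign conditions below are read off by sending one free variable of `E` to infinity.
  have hlin : ∀ c d : ℝ, (∀ t : ℝ, 0 < t → 0 ≤ c + t * d) → 0 ≤ c ∧ 0 ≤ d := by
    intro c d hcd
    constructor
    · have h1 : Tendsto (fun t : ℝ => c + t * d) (𝓝[>] 0) (𝓝 c) := by
        have : Continuous fun t : ℝ => c + t * d := by fun_prop
        simpa using (this.tendsto 0).mono_left nhdsWithin_le_nhds
      exact ge_of_tendsto h1 (by filter_upwards [self_mem_nhdsWithin] with t ht using hcd t ht)
    · by_contra! hd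
      have h1 := hcd ((|c| + 1) / -d) (div_pos (by positivity) (by linarith))
      have h2 : (|c| + 1) / -d * d = -(|c| + 1) := by
        have := hd.ne
        field_simp
      linarith [le_abs_self c]
  have hclosed : ∀ w, ∀ τ ∈ T, ∀ k ∈ K, ∀ s : ℝ, 0 ≤ s →
      0 ≤ l (L w) + l b - l τ - (l k - s * l y) + (∑ i, α i * g i w + ∑ i, α i * β i) := by
    intro w τ hτ k hk s hs
    refine (hlin _ (∑ i, α i * 1) fun t ht => ?_).1
    have := hmain w τ hτ k hk s hs (fun _ => t) fun _ _ => ht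
    simp only [mul_one]
    rwa [mul_comm t, Finset.sum_mul]
  have hαnonneg : ∀ i, 0 ≤ α i := by
    intro i
    refine (hlin (l (L 0) + l b - l τ₀ - (l 0 - 0 * l y) + (∑ j, α j * g j 0 + ∑ j, α j * β j)
      + ∑ j, α j) _ fun t ht => ?_).2
    have h1 := hmain 0 τ₀ hτ₀ 0 hK0 0 le_rfl (fun j => 1 + t * (Pi.single i 1 : Fin m → ℝ) j)
      fun j _ => by
        have : 0 ≤ (Pi.single i 1 : Fin m → ℝ) j := by
          rw [Pi.single_apply]; split_ifs <;> norm_num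
        have := mul_nonneg ht.le this
        linarith
    simp only [mul_add, mul_one, Finset.sum_add_distrib, Pi.single_apply, mul_ite, mul_zero,
      Finset.sum_ite_eq', Finset.mem_univ, if_true] at h1
    linarith
  -- Coordinates outside `I` are unconstrained in `E`, so they may tend to `-∞`.
  have hαI : ∀ i, α i ≠ 0 → i ∈ I := by
    intro i hi
    by_contra hiI
    refine hi (le_antisymm (neg_nonneg.1 ?_) (hαnonneg i))
    refine (hlin (l (L 0) + l b - l τ₀ - (l 0 - 0 * l y) + (∑ j, α j * g j 0 + ∑ j, α j * β j)
      + ∑ j, α j) _ fun t ht => ?_).2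
    have h1 := hmain 0 τ₀ hτ₀ 0 hK0 0 le_rfl (fun j => 1 + -t * (Pi.single i 1 : Fin m → ℝ) j)
      fun j hj => by
        have hji : j ≠ i := fun h => hiI (h ▸ hj)
        rw [Pi.single_eq_of_ne hji]
        norm_num
    simp only [mul_add, mul_one, Finset.sum_add_distrib, Pi.single_apply, mul_ite, mul_zero,
      Finset.sum_ite_eq', Finset.mem_univ, if_true] at h1
    linarith
  have hdual : ∀ w, 0 ≤ ∑ i, α i * g i w + l (L w) := by
    intro w
    refine (hlin (l b - l τ₀ - (l 0 - 0 * l y) + ∑ j, α j * β j) _ fun t ht => ?_).2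
    have h1 := hclosed (t • w) τ₀ hτ₀ 0 hK0 0 le_rfl
    simp only [map_smul, smul_eq_mul, mul_left_comm _ t, ← Finset.mul_sum] at h1
    linarith
  have hstat : ∀ w, ∑ i, α i * g i w + l (L w) = 0 := by
    intro w
    refine le_antisymm ?_ (hdual w)
    have h1 := hdual (-w)
    simp only [map_neg, mul_neg, Finset.sum_neg_distrib] at h1
    linarith
  have hlK : ∀ k ∈ K, l k ≤ 0 := by
    intro k hk
    rw [← neg_nonneg]
    refine (hlin (l (L 0) + l b - l τ₀ + (∑ j, α j * g j 0 + ∑ j, α j * β j)) _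
      fun t ht => ?_).2
    have h1 := hclosed 0 τ₀ hτ₀ (t • k) (K.smul_mem ht hk) 0 le_rfl
    rw [map_smul, smul_eq_mul] at h1
    linarith
  have hly : l y = 0 := by
    refine le_antisymm (hlK y hy) ?_
    refine (hlin (l (L 0) + l b - l τ₀ - l 0 + (∑ j, α j * g j 0 + ∑ j, α j * β j)) _
      fun t ht => ?_).2
    have h1 := hclosed 0 τ₀ hτ₀ 0 hK0 t ht.le
    linarith
  have hlT : ∀ τ ∈ T, l τ ≤ ∑ i, α i * β i + l b := by
    intro τ hτ
    have h1 := hclosed 0 τ hτ 0 hK0 0 le_rfl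
    simp only [map_zero, mul_zero, Finset.sum_const_zero, zero_mul] at h1
    linarith
  -- If `α = 0`, stationarity kills `l ∘ L`, so `hreg` makes `l ≥ 0` on a ball and hence zero, while
  -- `φ > 0` on `interior E`.
  have hS : 0 < ∑ i, α i := by
    refine (Finset.sum_nonneg fun i _ => hαnonneg i).lt_of_ne fun hS => ?_
    have hα0 : ∀ i, α i = 0 := fun i =>
      (Finset.sum_eq_zero_iff_of_nonneg fun i _ => hαnonneg i).1 hS.symm i (Finset.mem_univ i)
    have hl0 : ∀ z : Y, ‖z‖ ≤ δ → 0 ≤ l z := by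
      intro z hz
      obtain ⟨w, -, k, hk, rfl⟩ := hreg z hz
      have h1 := hstat w
      simp only [hα0, zero_mul, Finset.sum_const_zero, zero_add] at h1
      rw [map_sub, map_add, hly, h1]
      linarith [hlK k hk]
    obtain ⟨p, hp⟩ := hint
    have hpos : 0 < l p.1 := by
      have h1 := hφ p hp
      rw [← Prod.mk.eta (p := p), hφeq] at h1
      simpa [hα0] using h1
    have h1 := hl0 (-(δ / (‖p.1‖ + 1)) • p.1) (by
      rw [norm_smul, norm_neg, Real.norm_of_nonneg (by positivity), div_mul_eq_mul_div,
        div_le_iff₀ (by positivity)]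
      nlinarith)
    rw [map_smul, smul_eq_mul] at h1
    have h2 : 0 < δ / (‖p.1‖ + 1) * l p.1 := by positivity
    linarith
  set S := ∑ i, α i
  have hsum : ∀ u : Fin m → ℝ, ∑ i, S⁻¹ * α i * u i = S⁻¹ * ∑ i, α i * u i := by
    intro u
    rw [Finset.mul_sum]
    exact Finset.sum_congr rfl fun i _ => mul_assoc _ _ _
  refine ⟨S⁻¹ • l, fun i => S⁻¹ * α i, fun i => mul_nonneg (by positivity) (hαnonneg i), ?_,
    fun i hi => hαI i (right_ne_zero_of_mul hi), fun k hk => ?_, ?_, fun w => ?_, fun τ hτ => ?_⟩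
  · rw [← Finset.mul_sum, inv_mul_cancel₀ hS.ne']
  · exact mul_nonpos_of_nonneg_of_nonpos (by positivity) (hlK k hk)
  · change S⁻¹ * l y = 0
    rw [hly, mul_zero]
  · change _ + S⁻¹ * l (L w) = 0
    rw [hsum, ← mul_add, hstat, mul_zero]
  · change S⁻¹ * l τ ≤ _ + S⁻¹ * l b
    rw [hsum, ← mul_add]
    exact mul_le_mul_of_nonneg_left (hlT τ hτ) (by positivity)

theorem hessianForm_eq {f : Fin m → X → ℝ} {G : X → Y} {x : X}
    (hf : ∀ i, ContDiffAt ℝ 2 (f i) x) (hG : ContDiffAt ℝ 2 G x) (l : StrongDual ℝ Y)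
    (α : Fin m → ℝ) (h : X) :
    hessianForm f G x l α h =
      ∑ i, α i * fderiv ℝ (fderiv ℝ (f i)) x h h + l (fderiv ℝ (fderiv ℝ G) x h h) := by
  have h1 : (fderiv ℝ fun z => integralLagrangian f G z l α) =ᶠ[𝓝 x]
      fun z => ∑ i, α i • fderiv ℝ (f i) z + l.comp (fderiv ℝ G z) := by
    filter_upwards [eventually_all.2 fun i => eventually_differentiableAt (hf i), eventually_differentiableAt hG] with z hz hz'
    exact ((HasFDerivAt.fun_sum fun i _ => (hz i).hasFDerivAt.const_mul (α i)).add
      (l.hasFDerivAt.comp z hz'.hasFDerivAt)).fderiv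
  have h2 : HasFDerivAt (fun z => ∑ i, α i • fderiv ℝ (f i) z + l.comp (fderiv ℝ G z))
      (∑ i, α i • fderiv ℝ (fderiv ℝ (f i)) x +
        (ContinuousLinearMap.compL ℝ X Y ℝ l).comp (fderiv ℝ (fderiv ℝ G) x)) x :=
    (HasFDerivAt.fun_sum fun i _ => (hasFDerivAt_fderiv_of_contDiffAt (hf i)).const_smul (α i)).add
      ((ContinuousLinearMap.compL ℝ X Y ℝ l).hasFDerivAt.comp x (hasFDerivAt_fderiv_of_contDiffAt hG))
  rw [hessianForm, h1.fderiv_eq, h2.fderiv]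
  simp

/-- Second order necessary condition in terms of a single pair of multipliers, for a nonempty
convex set of second order tangents. -/
theorem exists_multipliers_of_isLocalSolution [FiniteDimensional ℝ X] [CompleteSpace Y]
    (hm : 1 ≤ m) {A : Set X} {K : ConvexCone ℝ Y} (hcl : IsClosed (K : Set Y))
    {f : Fin m → X → ℝ} {G : X → Y} {x : X} (hf : ∀ i, ContDiffAt ℝ 2 (f i) x)
    (hG : ContDiffAt ℝ 2 G x) (hxA : x ∈ interior A)
    (hloc : IsLocalSolution A (K : Set Y) f G x) (hR : RCQ A (K : Set Y) G x) {h : X}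
    (hh : ∀ i, f i x = maxFun f x → fderiv ℝ (f i) x h ≤ 0) {T : Set Y} (hTconv : Convex ℝ T)
    (hTne : T.Nonempty)
    (hT : T ⊆ secondOrderTangentSet (K : Set Y) (G x) (fderiv ℝ G x h)) :
    ∃ l ∈ lagrangeMultipliers A (K : Set Y) f G x, ∃ α ∈ danskinDemyanovMultipliers A f G x l,
      ∀ τ ∈ T, l τ ≤ hessianForm f G x l α h := by
  have hfd : ∀ i, DifferentiableAt ℝ (f i) x := fun i => (hf i).differentiableAt (by simp)
  have hGd : DifferentiableAt ℝ G x := hG.differentiableAt (by simp)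
  obtain ⟨δ, hδ, hreg⟩ := exists_closedBall_subset_of_decomposition hcl (fderiv ℝ G x)
    hloc.1.2 (exists_decomposition_of_RCQ hR)
  -- The index set keeps only active functions with zero slope along `h` (nonnegative here,
  -- nonpositive by `hh`): those with negative slope decrease already at first order.
  obtain ⟨l, α, hα0, hα1, hαI, hlK, hly, hstat, hlT⟩ :=
    exists_multipliers_of_linearized hcl hloc.1.2 hδ hreg hTconv hTne
      (fderiv ℝ (fderiv ℝ G) x h h) {i | f i x = maxFun f x ∧ 0 ≤ fderiv ℝ (f i) x h}
      (fun i => fderiv ℝ (f i) x) (fun i => fderiv ℝ (fderiv ℝ (f i)) x h h) (by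
        intro w τ hτ k hk s hs hw
        obtain ⟨i, hi, hi0, hi1⟩ := exists_active_nonneg_of_isLocalSolution hm hcl K.convex hf hG
          hxA hloc hδ hreg hh (w := w) (by
            rw [hw]
            exact add_sub_smul_mem_secondOrderTangentSet hcl hloc.1.2 (hT hτ) hk hs)
        exact ⟨i, ⟨hi, hi0⟩, hi1⟩)
  refine ⟨l, ⟨hlK, hly, fun u _ => ?_⟩, α,
    ⟨hα0, hα1, fun i hi => (hαI i hi).1, fun u _ => (hstat u).ge⟩, fun τ hτ => ?_⟩
  · obtain ⟨v, hv, hle⟩ := exists_hasDirDeriv_maxFun hm hfd u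
    refine ⟨v + l (fderiv ℝ G x u), ?_, ?_⟩
    · have h1 : HasDirDeriv (fun z => l (G z)) x u (l (fderiv ℝ G x u)) := by
        have h2 : HasFDerivAt (fun z => l (G z)) (l.comp (fderiv ℝ G x)) x :=
          l.hasFDerivAt.comp x hGd.hasFDerivAt
        have h3 := tendsto_slope_of_differentiableAt h2.differentiableAt u
        rwa [h2.fderiv] at h3
      refine (Tendsto.add hv h1).congr fun t => ?_
      simp only [lagrangian]
      ring
    · have h1 : ∑ i, α i * fderiv ℝ (f i) x u ≤ ∑ i, α i * v := by
        refine Finset.sum_le_sum fun i _ => ?_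
        rcases eq_or_ne (α i) 0 with hi | hi
        · simp [hi]
        · exact mul_le_mul_of_nonneg_left (hle i (hαI i hi).1) (hα0 i)
      rw [← Finset.sum_mul, hα1, one_mul] at h1
      linarith [hstat u]
  · rw [hessianForm_eq hf hG]
    exact hlT τ hτ

end

end ConeMinimax

theorem mainTheorem10 {d m : ℕ} (hm : 1 ≤ m)
    {Y : Type*} [NormedAddCommGroup Y] [NormedSpace ℝ Y] [CompleteSpace Y]
    (A : Set (EuclideanSpace ℝ (Fin d))) (hAclosed : IsClosed A) (hAconv : Convex ℝ A)
    (K : ConvexCone ℝ Y) (hKne : (K : Set Y).Nonempty) (hKclosed : IsClosed (K : Set Y))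
    (f : Fin m → EuclideanSpace ℝ (Fin d) → ℝ) (G : EuclideanSpace ℝ (Fin d) → Y)
    (xs : EuclideanSpace ℝ (Fin d))
    (hf : ∀ i, ContDiffAt ℝ 2 (f i) xs) (hG : ContDiffAt ℝ 2 G xs)
    (hxA : xs ∈ interior A)
    (hloc : ConeMinimax.IsLocalSolution A (K : Set Y) f G xs)
    (hRCQ : ConeMinimax.RCQ A (K : Set Y) G xs)
    (h : EuclideanSpace ℝ (Fin d))
    (hh : h ∈ ConeMinimax.criticalCone A (K : Set Y) f G xs)
    (T : Set Y) (hTconv : Convex ℝ T)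
    (hT : T ⊆ ConeMinimax.secondOrderTangentSet (K : Set Y) (G xs) (fderiv ℝ G xs h)) :
    (0 : EReal) ≤
      ⨆ l ∈ ConeMinimax.lagrangeMultipliers A (K : Set Y) f G xs,
        ((⨆ α ∈ ConeMinimax.danskinDemyanovMultipliers A f G xs l,
            ((ConeMinimax.hessianForm f G xs l α h : ℝ) : EReal))
          - ConeMinimax.supportFunction l T) := by
  obtain ⟨l, hl, α, hα, hlα⟩ : ∃ l ∈ ConeMinimax.lagrangeMultipliers A (K : Set Y) f G xs,
      ∃ α ∈ ConeMinimax.danskinDemyanovMultipliers A f G xs l,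
        ∀ τ ∈ T, l τ ≤ ConeMinimax.hessianForm f G xs l α h := by
    rcases T.eq_empty_or_nonempty with rfl | hTne
    -- For empty `T` only the existence of multipliers is needed; direction `0` with tangent set
    -- `{0}` provides it.
    · obtain ⟨l, hl, α, hα, -⟩ := ConeMinimax.exists_multipliers_of_isLocalSolution hm hKclosed
        hf hG hxA hloc hRCQ (h := 0) (by simp) (convex_singleton (0 : Y))
        (Set.singleton_nonempty _) (by
          rintro _ rfl
          refine ⟨fun n => 1 / ((n : ℝ) + 1), fun n => by positivity,
            tendsto_one_div_add_atTop_nhds_zero_nat, ?_⟩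
          have h0 : Metric.infDist (G xs) (K : Set Y) = 0 := Metric.infDist_zero_of_mem hloc.1.2
          simp [h0])
      exact ⟨l, hl, α, hα, by simp⟩
    · obtain ⟨-, -, v, hv, hv0⟩ := hh
      exact ConeMinimax.exists_multipliers_of_isLocalSolution hm hKclosed hf hG hxA hloc hRCQ
        (fun i hi => (ConeMinimax.fderiv_le_of_hasDirDeriv_maxFun
          ((hf i).differentiableAt (by simp)) hi hv).trans hv0) hTconv hTne hT
  refine le_iSup₂_of_le l hl ?_
  have h1 : ConeMinimax.supportFunction l T ≤
      ((ConeMinimax.hessianForm f G xs l α h : ℝ) : EReal) :=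
    iSup₂_le fun τ hτ => EReal.coe_le_coe_iff.2 (hlα τ hτ)
  -- Passing through a real number avoids the indeterminate differences of `EReal`.
  calc (0 : EReal) = ((ConeMinimax.hessianForm f G xs l α h : ℝ) : EReal) -
        ((ConeMinimax.hessianForm f G xs l α h : ℝ) : EReal) := by
        rw [← EReal.coe_sub, sub_self, EReal.coe_zero]
    _ ≤ _ := EReal.sub_le_sub (le_iSup₂_of_le α hα le_rfl) h1
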